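/- Let $k\ge 0$ and let $T_k=\mathbb{N}^k$, regarded as a $k$-graph with one vertex $0$ and with the identity as degree map. Its $r$-cubes are the $n\in\mathbb{N}^k$ with $n\le(1,\dots,1)$ and $|n|=r$; in particular $Q_2(T_k)=\{e_m+e_n: 1\le m<n\le k\}$. For a $2$-cocycle $\varphi\in Z^2(T_k,\mathbb{T})$ in the cubical cochain complex of $T_k$, let $C^*_\varphi(T_k)$ be the universal $C^*$-algebra generated by a Cuntz–Krieger $\varphi$-representation of $T_k$, that is, by a projection $p_0$ and elements $S_{e_1},\dots,S_{e_k}$ such that $S_{e_i}^*S_{e_i}=p_0=S_{e_i}S_{e_i}^*$ for all $i$ and $S_{e_j}S_{e_i}=\varphi(e_i+e_j)S_{e_i}S_{e_j}$ for $i<j$. For a skew-symmetric real $k\times k$ matrix $\theta$, let $A_\theta$ be the noncommutative torus: the universal unital $C^*$-algebra generated by unitaries $u_1,\dots,u_k$ with $$u_nu_m=e^{2\pi i\theta_{m,n}}u_mu_n\qquad(1\le m,n\le k).\qquad(*)$$ 1. For every skew-symmetric real $k\times k$ matrix $\theta$, the formula $\varphi(\theta)(e_m+e_n)=e^{2\pi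 i\theta_{m,n}}$ for $m<n$ determines a unique $\mathbb{T}$-valued $2$-cochain $\varphi(\theta)$ on $T_k$, and it is a $2$-cocycle. The $C^*$-algebra $C^*_{\varphi(\theta)}(T_k)$ is unital with unit $p_0$, and it is the universal unital $C^*$-algebra generated by $k$ unitaries $S_{e_1},\dots,S_{e_k}$ satisfying $(*)$. Hence there is a $*$-isomorphism $C^*_{\varphi(\theta)}(T_k)\cong A_\theta$ with $p_0\mapsto 1$ and $S_{e_i}\mapsto u_i$ for all $i$; so every noncommutative torus is a twisted $k$-graph $C^*$-algebra. 2. Conversely, for every $\varphi\in Z^2(T_k,\mathbb{T})$ there is a skew-symmetric real $k\times k$ matrix $\theta$ with $\varphi(e_m+e_n)=e^{2\pi i\theta_{m,n}}$ for all $m<n$, and a $*$-isomorphism $C^*_\varphi(T_k)\cong A_\theta$ with $p_0\mapsto 1$ and $S_{e_i}\mapsto u_i$ for all $i$. So the twisted $C^*$-algebras of $T_k$ correspond exactly to the noncommutative tori. -/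

import Mathlib

open CategoryTheory

open scoped ENNReal

noncomputable section

universe u

/-- The standard generator `e_i` of `ℕ^k`. -/
def stdGen {k : ℕ} (i : Fin k) : Fin k → ℕ := Pi.single i 1

/-- A `k`-graph: a nonempty countable small category with a degree functor to `ℕ^k` that satisfies
the factorisation property. With the usual convention for paths, the composite `μν` (defined when
`s(μ) = r(ν)`) is the categorical composite "first `ν`, then `μ`", that is `ν ≫ μ`. -/
structure KGraph (k : ℕ) where
  Obj : Type u
  [category : SmallCategory Obj]
  [nonempty : Nonempty Obj]
  countable_hom : Countable (Σ a b : Obj, a ⟶ b)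
  degree : ∀ {a b : Obj}, (a ⟶ b) → (Fin k → ℕ)
  degree_id : ∀ a : Obj, degree (𝟙 a) = 0
  degree_comp : ∀ {a b c : Obj} (ν : a ⟶ b) (μ : b ⟶ c), degree (ν ≫ μ) = degree μ + degree ν
  factorisation : ∀ {a b : Obj} (l : a ⟶ b) (m n : Fin k → ℕ), degree l = m + n →
    ∃! x : Σ c : Obj, (c ⟶ b) × (a ⟶ c), degree x.2.1 = m ∧ degree x.2.2 = n ∧ x.2.2 ≫ x.2.1 = l

namespace KGraph

attribute [instance] KGraph.category KGraph.nonempty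

variable {k : ℕ} (Λ : KGraph.{u} k)

/-- The elements of a `k`-graph: its morphisms. Vertices (identity morphisms) are identified with
objects. -/
structure Path where
  src : Λ.Obj
  rng : Λ.Obj
  hom : src ⟶ rng

variable {Λ}

/-- The degree `d(λ)` of a path. -/
def Path.deg (l : Λ.Path) : Fin k → ℕ := Λ.degree l.hom

/-- The composite `μν` of paths with `s(μ) = r(ν)`. -/
def Path.comp (μ ν : Λ.Path) (h : μ.src = ν.rng) : Λ.Path where
  src := ν.src
  rng := μ.rng
  hom := ν.hom ≫ eqToHom h.symm ≫ μ.hom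

variable (Λ)

/-- `Λ^{e_i}`: the edges of degree `e_i`. -/
def Edge (i : Fin k) : Type u := {l : Λ.Path // l.deg = stdGen i}

/-- `v Λ^{n}`: the paths of degree `n` with range `v`. -/
def pathsInto (v : Λ.Obj) (n : Fin k → ℕ) : Set Λ.Path := {l | l.rng = v ∧ l.deg = n}

/-- Row-finite, locally convex `k`-graphs. -/
structure RowFiniteLocallyConvex : Prop where
  rowFinite : ∀ (v : Λ.Obj) (n : Fin k → ℕ), (Λ.pathsInto v n).Finite
  locallyConvex : ∀ i j : Fin k, i ≠ j → ∀ e : Λ.Edge i,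
    (Λ.pathsInto e.1.rng (stdGen j)).Nonempty → (Λ.pathsInto e.1.src (stdGen j)).Nonempty

/-- `Q_r(Λ)`: the `r`-cubes, i.e. the paths with `d(λ) ≤ (1, …, 1)` and `|λ| = r`. -/
def Cube (r : ℕ) : Type u := {l : Λ.Path // (∀ i, l.deg i ≤ 1) ∧ ∑ i, l.deg i = r}

variable {Λ}

theorem Path.exists_factor (l : Λ.Path) (m n : Fin k → ℕ) (h : l.deg = m + n) :
    ∃ x : Λ.Path × Λ.Path, ∃ hx : x.1.src = x.2.rng,
      x.1.deg = m ∧ x.2.deg = n ∧ x.1.comp x.2 hx = l := by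
  obtain ⟨⟨c, μ, ν⟩, ⟨h1, h2, h3⟩, -⟩ := Λ.factorisation l.hom m n h
  refine ⟨(⟨c, l.rng, μ⟩, ⟨l.src, c, ν⟩), rfl, h1, h2, ?_⟩
  simp only [Path.comp, eqToHom_refl, Category.id_comp]
  rw [h3]

/-- The unique `μ` with `d(μ) = m` and `λ = μν` for some `ν` of degree `n`, where
`d(λ) = m + n`. -/
def Path.initialPart (l : Λ.Path) (m n : Fin k → ℕ) (h : l.deg = m + n) : Λ.Path :=
  (l.exists_factor m n h).choose.1

/-- The unique `ν` with `d(ν) = n` and `λ = μν` for some `μ` of degree `m`, where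
`d(λ) = m + n`. -/
def Path.finalPart (l : Λ.Path) (m n : Fin k → ℕ) (h : l.deg = m + n) : Λ.Path :=
  (l.exists_factor m n h).choose.2

theorem Path.deg_initialPart (l : Λ.Path) (m n : Fin k → ℕ) (h : l.deg = m + n) :
    (l.initialPart m n h).deg = m :=
  (l.exists_factor m n h).choose_spec.choose_spec.1

theorem Path.deg_finalPart (l : Λ.Path) (m n : Fin k → ℕ) (h : l.deg = m + n) :
    (l.finalPart m n h).deg = n :=
  (l.exists_factor m n h).choose_spec.choose_spec.2.1

/-- The directions `i_1 < ⋯ < i_r` of an `r`-cube of degree `e_{i_1} + ⋯ + e_{i_r}`. -/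
def Cube.dirs {r : ℕ} (l : Λ.Cube r) : Finset (Fin k) := {i | l.1.deg i = 1}

theorem Cube.deg_split {r : ℕ} (l : Λ.Cube r) {i : Fin k} (hi : i ∈ l.dirs) :
    l.1.deg = (l.1.deg - stdGen i) + stdGen i := by
  funext j
  have h1 : l.1.deg i = 1 := by simpa [Cube.dirs] using hi
  by_cases hj : j = i
  · subst hj; simp [stdGen, h1]
  · simp [stdGen, hj]

theorem Cube.face_mem {r : ℕ} (l : Λ.Cube (r + 1)) {i : Fin k} (hi : i ∈ l.dirs) (p : Λ.Path)
    (hp : p.deg = l.1.deg - stdGen i) : (∀ j, p.deg j ≤ 1) ∧ ∑ j, p.deg j = r := by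
  constructor
  · intro j
    rw [hp]
    exact (Nat.sub_le _ _).trans (l.2.1 j)
  · have h := l.2.2
    rw [l.deg_split hi, ← hp] at h
    simpa [stdGen, Finset.sum_add_distrib] using h

/-- The face `F_j^0(λ) = λ(0, d(λ) - e_i)`, where `i = i_j` is the `j`-th direction of `λ`. -/
def Cube.face0 {r : ℕ} (l : Λ.Cube (r + 1)) (i : Fin k) (hi : i ∈ l.dirs) : Λ.Cube r :=
  ⟨l.1.initialPart (l.1.deg - stdGen i) (stdGen i) (l.deg_split hi),
    l.face_mem hi _ (l.1.deg_initialPart _ _ _)⟩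

/-- The face `F_j^1(λ) = λ(e_i, d(λ))`, where `i = i_j` is the `j`-th direction of `λ`. -/
def Cube.face1 {r : ℕ} (l : Λ.Cube (r + 1)) (i : Fin k) (hi : i ∈ l.dirs) : Λ.Cube r :=
  ⟨l.1.finalPart (stdGen i) (l.1.deg - stdGen i) ((l.deg_split hi).trans (add_comm _ _)),
    l.face_mem hi _ (l.1.deg_finalPart _ _ _)⟩

/-- The position `j ∈ {1, …, r}` of the direction `i = i_j` among `i_1 < ⋯ < i_r`. -/
def Cube.pos {r : ℕ} (l : Λ.Cube r) (i : Fin k) : ℕ := {i' ∈ l.dirs | i' ≤ i}.card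

variable (Λ)

/-- `C^r(Λ, A)`: the `r`-cochains with values in the abelian group `A`. -/
abbrev Cochain (r : ℕ) (A : Type*) [AddCommGroup A] := Λ.Cube r → A

/-- The coboundary map
`δ^r(f)(λ) = ∑_{j=1}^{r+1} ((-1)^j f(F_j^0(λ)) + (-1)^{j+1} f(F_j^1(λ)))`. -/
def coboundary (r : ℕ) (A : Type*) [AddCommGroup A] : Λ.Cochain r A →+ Λ.Cochain (r + 1) A where
  toFun f l := ∑ i : l.dirs,
    ((-1 : ℤ) ^ l.pos i • f (l.face0 i i.2) + (-1 : ℤ) ^ (l.pos i + 1) • f (l.face1 i i.2))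
  map_zero' := by funext l; simp
  map_add' f g := by
    funext l
    simp only [Pi.add_apply, smul_add, ← Finset.sum_add_distrib]
    exact Finset.sum_congr rfl fun _ _ => by abel

/-- `Z^r(Λ, A)`: the `r`-cocycles. -/
def Cocycle (r : ℕ) (A : Type*) [AddCommGroup A] : AddSubgroup (Λ.Cochain r A) :=
  (Λ.coboundary r A).ker

/-- `𝕋`, written additively so as to serve as a coefficient group. -/
abbrev AddT := Additive Circle

/-- The complex number underlying an element of `𝕋`. -/
def AddT.val (z : AddT) : ℂ := ((Additive.toMul z : Circle) : ℂ)

variable {Λ}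

/-- Cuntz-Krieger `φ`-representations of a row-finite locally convex `k`-graph `Λ` in a
C*-algebra `B`: projections `p_v` indexed by the vertices and elements `s_λ` indexed by the
edges. -/
structure IsCuntzKriegerRep (hΛ : Λ.RowFiniteLocallyConvex) (φ : Λ.Cocycle 2 AddT)
    {B : Type*} [NonUnitalCStarAlgebra B] (p : Λ.Obj → B) (s : ∀ i, Λ.Edge i → B) : Prop where
  projection : ∀ v, IsStarProjection (p v)
  orthogonal : ∀ v w, v ≠ w → p v * p w = 0
  ck1 : ∀ i (e : Λ.Edge i), star (s i e) * s i e = p e.1.src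
  ck2 : ∀ i j, i < j → ∀ (μ μ' : Λ.Edge i) (ν ν' : Λ.Edge j)
    (h : μ.1.src = ν.1.rng) (h' : ν'.1.src = μ'.1.rng) (c : Λ.Cube 2),
    μ.1.comp ν.1 h = c.1 → ν'.1.comp μ'.1 h' = c.1 →
    s j ν' * s i μ' = (φ.1 c).val • (s i μ * s j ν)
  ck3 : ∀ v i, (Λ.pathsInto v (stdGen i)).Nonempty →
    p v = ∑ e ∈ (hΛ.rowFinite v (stdGen i)).toFinset.attach,
      s i ⟨e.1, ((hΛ.rowFinite v (stdGen i)).mem_toFinset.1 e.2).2⟩ *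
        star (s i ⟨e.1, ((hΛ.rowFinite v (stdGen i)).mem_toFinset.1 e.2).2⟩)

/-- The Cuntz-Krieger `φ`-representations of `Λ` in the C*-algebras of `Type`. As `Λ` is
countable, the C*-algebra generated by a Cuntz-Krieger `φ`-representation has at most the
cardinality of the continuum, so up to isomorphism these are all the Cuntz-Krieger
`φ`-representations. -/
structure CKRepresentation (hΛ : Λ.RowFiniteLocallyConvex) (φ : Λ.Cocycle 2 AddT) where
  B : Type
  [cstar : NonUnitalCStarAlgebra B]
  p : Λ.Obj → B
  s : ∀ i, Λ.Edge i → B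
  isRep : IsCuntzKriegerRep hΛ φ p s

attribute [instance] CKRepresentation.cstar

section Universal

variable (hΛ : Λ.RowFiniteLocallyConvex) (φ : Λ.Cocycle 2 AddT)

/-- The C*-algebra of bounded families indexed by all Cuntz-Krieger `φ`-representations. -/
abbrev RepProduct := lp (fun π : CKRepresentation hΛ φ => π.B) ∞

theorem CKRepresentation.norm_p_le (π : CKRepresentation hΛ φ) (v : Λ.Obj) : ‖π.p v‖ ≤ 1 :=
  (π.isRep.projection v).norm_le

theorem CKRepresentation.norm_s_le (π : CKRepresentation hΛ φ) (i : Fin k) (e : Λ.Edge i) :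
    ‖π.s i e‖ ≤ 1 := by
  have h : ‖π.s i e‖ * ‖π.s i e‖ ≤ 1 := by
    rw [← CStarRing.norm_star_mul_self, π.isRep.ck1]
    exact π.norm_p_le hΛ φ _
  nlinarith [norm_nonneg (π.s i e)]

/-- The family `(p_v)` over all representations. -/
def prodP (v : Λ.Obj) : RepProduct hΛ φ :=
  ⟨fun π => π.p v, memℓp_infty ⟨1, by rintro _ ⟨π, rfl⟩; exact π.norm_p_le hΛ φ v⟩⟩

/-- The family `(s_e)` over all representations. -/
def prodS (i : Fin k) (e : Λ.Edge i) : RepProduct hΛ φ :=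
  ⟨fun π => π.s i e, memℓp_infty ⟨1, by rintro _ ⟨π, rfl⟩; exact π.norm_s_le hΛ φ i e⟩⟩

/-- The closed *-subalgebra generated by the universal family. -/
def twistedSubalgebra : NonUnitalStarSubalgebra ℂ (RepProduct hΛ φ) :=
  (NonUnitalStarAlgebra.adjoin ℂ
    (Set.range (prodP hΛ φ) ∪ ⋃ i, Set.range (prodS hΛ φ i))).topologicalClosure

/-- The twisted `k`-graph C*-algebra `C*_φ(Λ)`: the universal C*-algebra generated by a
Cuntz-Krieger `φ`-representation of `Λ`. The norm of a *-polynomial in the generators is the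
supremum of its norms over all Cuntz-Krieger `φ`-representations. -/
def TwistedAlgebra : Type (max 1 u) := twistedSubalgebra hΛ φ

instance : NonUnitalCStarAlgebra (TwistedAlgebra hΛ φ) :=
  NonUnitalStarSubalgebra.nonUnitalCStarAlgebra (twistedSubalgebra hΛ φ)
    (h_closed := NonUnitalStarSubalgebra.isClosed_topologicalClosure _)

/-- The generating projection `p_v` of `C*_φ(Λ)`. -/
def twistedP (v : Λ.Obj) : TwistedAlgebra hΛ φ :=
  ⟨prodP hΛ φ v, NonUnitalStarSubalgebra.le_topologicalClosure _
    (NonUnitalStarAlgebra.subset_adjoin ℂ _ (Or.inl ⟨v, rfl⟩))⟩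

/-- The generator `s_e` of `C*_φ(Λ)`. -/
def twistedS (i : Fin k) (e : Λ.Edge i) : TwistedAlgebra hΛ φ :=
  ⟨prodS hΛ φ i e, NonUnitalStarSubalgebra.le_topologicalClosure _
    (NonUnitalStarAlgebra.subset_adjoin ℂ _ (Or.inr (Set.mem_iUnion.2 ⟨i, e, rfl⟩)))⟩

end Universal

section Tk

variable (k)

/-- The `k`-graph `T_k = ℕ^k`, with one vertex and the identity map as degree map. -/
def T : KGraph.{0} k where
  Obj := SingleObj (Multiplicative (Fin k → ℕ))
  nonempty := ⟨SingleObj.star _⟩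
  countable_hom := by
    have : Countable (SingleObj (Multiplicative (Fin k → ℕ))) := inferInstanceAs (Countable Unit)
    have : ∀ a b : SingleObj (Multiplicative (Fin k → ℕ)), Countable (a ⟶ b) :=
      fun _ _ => inferInstanceAs (Countable (Fin k → ℕ))
    infer_instance
  degree := fun l => Multiplicative.toAdd (show Multiplicative (Fin k → ℕ) from l)
  degree_id := fun _ => rfl
  degree_comp := fun _ _ => rfl
  factorisation := by
    intro a b l m n h
    refine ⟨⟨SingleObj.star _, Multiplicative.ofAdd m, Multiplicative.ofAdd n⟩,
      ⟨rfl, rfl, h.symm⟩, ?_⟩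
    rintro ⟨c, μ, ν⟩ ⟨h1, h2, -⟩
    obtain rfl : μ = Multiplicative.ofAdd m := h1
    obtain rfl : ν = Multiplicative.ofAdd n := h2
    rfl

variable {k}

/-- The unique vertex of `T_k`. -/
def tVertex : (T k).Obj := SingleObj.star (Multiplicative (Fin k → ℕ))

/-- The element `n` of `T_k = ℕ^k`, as a path. -/
def tPath (n : Fin k → ℕ) : (T k).Path := ⟨tVertex, tVertex, Multiplicative.ofAdd n⟩

/-- The edge `e_i` of `T_k`. -/
def tEdge (i : Fin k) : (T k).Edge i := ⟨tPath (stdGen i), rfl⟩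

/-- The `2`-cube `e_m + e_n` of `T_k`, for `m < n`. -/
def tSquare (m n : Fin k) (h : m < n) : (T k).Cube 2 :=
  ⟨tPath (stdGen m + stdGen n), by
    refine ⟨fun i => ?_, ?_⟩
    · change stdGen m i + stdGen n i ≤ 1
      simp only [stdGen, Pi.single_apply]
      split_ifs <;> omega
    · change ∑ i, (stdGen m i + stdGen n i) = 2
      simp [stdGen, Finset.sum_add_distrib]⟩

variable (k) in
theorem tRowFiniteLocallyConvex : (T k).RowFiniteLocallyConvex where
  rowFinite := fun v n => by
    refine (Set.finite_singleton (tPath n)).subset ?_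
    rintro ⟨a, b, l⟩ ⟨-, h⟩
    obtain rfl : l = Multiplicative.ofAdd n := h
    rfl
  locallyConvex := fun _ j _ _ _ => ⟨tPath (stdGen j), rfl, rfl⟩

variable (φ : (T k).Cocycle 2 AddT)

/-- The twisted C*-algebra `C*_φ(T_k)`. -/
abbrev TAlgebra : Type 1 := TwistedAlgebra (tRowFiniteLocallyConvex k) φ

/-- The generating projection of `C*_φ(T_k)`. -/
def tP : TAlgebra φ := twistedP (tRowFiniteLocallyConvex k) φ tVertex

/-- The generator `S_{e_i}` of `C*_φ(T_k)`. -/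
def tS (i : Fin k) : TAlgebra φ := twistedS (tRowFiniteLocallyConvex k) φ i (tEdge i)

end Tk

end KGraph

namespace NCTorus

variable {k : ℕ}

/-- The defining relations of the noncommutative torus: `u_1, …, u_k` are unitaries with
`u_n u_m = e^{2πiθ_{m,n}} u_m u_n` for all `m, n`. -/
def Relations (θ : Matrix (Fin k) (Fin k) ℝ) {B : Type*} [CStarAlgebra B] (w : Fin k → B) : Prop :=
  (∀ m, w m ∈ unitary B) ∧
  ∀ m n, w n * w m = Complex.exp (2 * Real.pi * Complex.I * θ m n) • (w m * w n)

/-- The tuples of unitaries with the above relations in nonzero unital C*-algebras of `Type`. As a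
C*-algebra generated by `k` elements has at most the cardinality of the continuum, up to
isomorphism these are all the tuples of such unitaries. -/
structure Representation (θ : Matrix (Fin k) (Fin k) ℝ) where
  B : Type
  [cstar : CStarAlgebra B]
  [nontrivial : Nontrivial B]
  w : Fin k → B
  rel : Relations θ w

attribute [instance] Representation.cstar Representation.nontrivial

variable (θ : Matrix (Fin k) (Fin k) ℝ)

/-- The unital C*-algebra of bounded families indexed by all representations. -/
abbrev RepProduct := lp (fun π : Representation θ => π.B) ∞

instance : CStarAlgebra (RepProduct θ) where

/-- The family `(u_i)` over all representations. -/
def prodU (i : Fin k) : RepProduct θ :=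
  ⟨fun π => π.w i, memℓp_infty ⟨1, by
    rintro _ ⟨π, rfl⟩
    exact (CStarRing.norm_of_mem_unitary (π.rel.1 i)).le⟩⟩

/-- The closed unital *-subalgebra generated by the universal family. -/
def torusSubalgebra : StarSubalgebra ℂ (RepProduct θ) :=
  (StarAlgebra.adjoin ℂ (Set.range (prodU θ))).topologicalClosure

end NCTorus

/-- The noncommutative torus `A_θ`: the universal (unital) C*-algebra generated by `k` unitaries
`u_1, …, u_k` with `u_n u_m = e^{2πiθ_{m,n}} u_m u_n` for all `m, n`. -/
def NCTorus {k : ℕ} (θ : Matrix (Fin k) (Fin k) ℝ) : Type 1 := NCTorus.torusSubalgebra θ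

instance {k : ℕ} (θ : Matrix (Fin k) (Fin k) ℝ) : CStarAlgebra (NCTorus θ) :=
  StarSubalgebra.cstarAlgebra (NCTorus.torusSubalgebra θ)
    (h_closed := StarSubalgebra.isClosed_topologicalClosure _)

/-- The generating unitary `u_i` of `A_θ`. -/
def NCTorus.gen {k : ℕ} (θ : Matrix (Fin k) (Fin k) ℝ) (i : Fin k) : NCTorus θ :=
  ⟨NCTorus.prodU θ i, StarSubalgebra.le_topologicalClosure _
    (StarAlgebra.subset_adjoin ℂ _ ⟨i, rfl⟩)⟩

end

-- In `T_k` a path is determined by its degree. Hence opposite faces of a cube coincide, the terms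
-- of the coboundary cancel in pairs, and every cochain is a cocycle (`T.mem_cocycle`). The squares
-- are exactly the `e_m + e_n` with `m < n`, so a 2-cocycle is a free choice of phases, one for each
-- pair `m < n`.
--
-- With one vertex and one edge in each direction, the Cuntz–Krieger relations say that `S_i* S_i =
-- p_0 = S_i S_i*` and that the `S_i` commute up to these phases. The projection `p_0` is a unit for
-- the generators, hence for the whole algebra (`tP_unit`), so the `S_i` are unitaries;
-- skew-symmetry extends the commutation rule from `m < n` to all pairs (`tS_commutation`). Thus
-- `C*_φ(T_k)` and `A_θ` have the same universal property, and the two induced homomorphisms are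
-- mutually inverse (`exists_equiv`).
--
-- Both universal algebras are built from representations in `Type`. To reach targets in any
-- universe, a tuple is first moved into a copy in `Type` of the C*-algebra that it generates
-- (`exists_small_lift`).

universe v

/-! ### Copies in `Type` of C*-algebras generated by small families -/

section SmallCopies

/-- Transfer of a C*-algebra structure along a bijection. -/
@[reducible]
noncomputable def Equiv.cstarAlgebra {D : Type*} {A : Type*} [CStarAlgebra A] (e : D ≃ A) :
    CStarAlgebra D :=
  letI r : Ring D := e.ring
  letI a : Algebra ℂ D := e.algebra ℂ
  let f : D ≃ₐ[ℂ] A := e.algEquiv ℂ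
  letI n : NormedRing D := NormedRing.induced D A f f.injective
  letI s : StarRing D := e.starRing
  letI na : NormedAlgebra ℂ D := NormedAlgebra.induced ℂ D A f
  have hstar : ∀ x : D, e (star x) = star (e x) := fun x => e.apply_symm_apply _
  have hmul : ∀ x y : D, e (x * y) = e x * e y := fun x y => e.apply_symm_apply _
  have hiso : Isometry e := AddMonoidHomClass.isometry_of_norm f fun _ => rfl
  { n, s, na with
    toCompleteSpace :=
      (IsometryEquiv.mk e hiso).completeSpace
    norm_mul_self_le := fun x => by
      change ‖e x‖ * ‖e x‖ ≤ ‖e (star x * x)‖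
      rw [hmul, hstar]
      exact CStarRing.norm_mul_self_le (e x)
    star_smul := (e.starModule ℂ).star_smul }

theorem exists_starAlgEquiv_of_small (A : Type*) [CStarAlgebra A] [Small.{v} A] :
    ∃ (D : Type v) (_ : CStarAlgebra D), Nonempty (D ≃⋆ₐ[ℂ] A) := by
  let e : Shrink.{v} A ≃ A := (equivShrink A).symm
  refine ⟨Shrink.{v} A, e.cstarAlgebra, ⟨?_⟩⟩
  let _ := e.cstarAlgebra
  exact
    { e with
      map_mul' := fun x y => e.apply_symm_apply _
      map_add' := fun x y => e.apply_symm_apply _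
      map_star' := fun x => e.apply_symm_apply _
      map_smul' := fun r x => e.apply_symm_apply _ }

/-- Every point of the closure is the limit of a sequence in `s`, limits are unique, and the
sequences in a small set form a small type. -/
theorem small_closure {X : Type*} [TopologicalSpace X] [T2Space X] [FrechetUrysohnSpace X]
    (s : Set X) [Small.{v} s] : Small.{v} (closure s) := by
  have hs : Small.{v} {u : ℕ → s // ∃ x, Filter.Tendsto (fun n => (u n : X))
      Filter.atTop (nhds x)} := small_subtype _ _
  refine small_of_surjective (f := fun u : {u : ℕ → s // ∃ x, Filter.Tendsto
    (fun n => (u n : X)) Filter.atTop (nhds x)} => (⟨u.2.choose, mem_closure_of_tendsto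
      u.2.choose_spec (Filter.Eventually.of_forall fun n => (u.1 n).2)⟩ : closure s)) ?_
  rintro ⟨x, hx⟩
  obtain ⟨u, hu, hux⟩ := mem_closure_iff_seq_limit.1 hx
  refine ⟨⟨fun n => ⟨u n, hu n⟩, x, hux⟩, Subtype.ext ?_⟩
  have h : ∃ y, Filter.Tendsto u Filter.atTop (nhds y) := ⟨x, hux⟩
  exact tendsto_nhds_unique h.choose_spec hux

variable {B : Type*} [CStarAlgebra B] {ι : Type}

/-- The *-polynomials in `w` are the image of the free algebra on two copies of `ι`, which lives in
`Type`. -/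
theorem StarAlgebra.small_adjoin_range (w : ι → B) :
    Small.{0} (StarAlgebra.adjoin ℂ (Set.range w)) := by
  have h : (StarAlgebra.adjoin ℂ (Set.range w)).toSubalgebra =
      (FreeAlgebra.lift ℂ (Sum.elim w fun i => star (w i))).range := by
    rw [← Algebra.adjoin_range_eq_range_freeAlgebra_lift, StarAlgebra.adjoin_toSubalgebra,
      Set.Sum.elim_range, ← Set.image_star, ← Set.range_comp]
    rfl
  have h' : (StarAlgebra.adjoin ℂ (Set.range w) : Set B) =
      Set.range (FreeAlgebra.lift ℂ (Sum.elim w fun i => star (w i))) :=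
    congrArg (fun S : Subalgebra ℂ B => (S : Set B)) h
  change Small.{0} (StarAlgebra.adjoin ℂ (Set.range w) : Set B)
  rw [h']
  infer_instance

/-- A tuple in a C*-algebra is the image of a tuple in a C*-algebra of `Type` under an injective
unital *-homomorphism. -/
theorem exists_small_lift (w : ι → B) :
    ∃ (D : Type) (_ : CStarAlgebra D) (f : D →⋆ₐ[ℂ] B) (w' : ι → D),
      Function.Injective f ∧ ∀ i, f (w' i) = w i := by
  let S := (StarAlgebra.adjoin ℂ (Set.range w)).topologicalClosure
  let _ : CStarAlgebra S := StarSubalgebra.cstarAlgebra S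
    (h_closed := StarSubalgebra.isClosed_topologicalClosure _)
  have : Small.{0} (StarAlgebra.adjoin ℂ (Set.range w) : Set B) :=
    StarAlgebra.small_adjoin_range w
  have : Small.{0} S := small_closure (StarAlgebra.adjoin ℂ (Set.range w) : Set B)
  obtain ⟨D, hD, ⟨e⟩⟩ := exists_starAlgEquiv_of_small.{0} S
  let w₀ : ι → S := fun i => ⟨w i, StarSubalgebra.le_topologicalClosure _
    (StarAlgebra.subset_adjoin ℂ _ ⟨i, rfl⟩)⟩
  refine ⟨D, hD, S.subtype.comp (e : D →⋆ₐ[ℂ] S), fun i => e.symm (w₀ i), ?_, fun i => ?_⟩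
  · exact Subtype.val_injective.comp e.injective
  · change ((e (e.symm (w₀ i)) : S) : B) = w i
    rw [e.apply_symm_apply]

end SmallCopies

/-! ### Units, evaluation maps and continuity -/

section Unit

/-- A C*-algebra with a two-sided unit, as a unital C*-algebra. -/
@[reducible]
noncomputable def NonUnitalCStarAlgebra.cstarAlgebraOfUnit {A : Type*} (h : NonUnitalCStarAlgebra A)
    (p : A) (hp : ∀ x : A, p * x = x ∧ x * p = x) : CStarAlgebra A :=
  letI r : NormedRing A :=
    { h with
      one := p
      one_mul := fun x => (hp x).1
      mul_one := fun x => (hp x).2 }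
  letI a : Algebra ℂ A := Algebra.ofModule smul_mul_assoc mul_smul_comm
  { r, h with
    algebraMap := a.algebraMap
    commutes' := a.commutes'
    smul_def' := a.smul_def' }

end Unit

/-- Evaluation of bounded families at an index. -/
def lp.evalStarAlgHom {I : Type*} (B : I → Type*) [∀ i, NonUnitalCStarAlgebra (B i)] (i : I) :
    lp B ∞ →⋆ₙₐ[ℂ] B i where
  toFun f := f i
  map_smul' _ _ := rfl
  map_zero' := rfl
  map_add' _ _ := rfl
  map_mul' _ _ := rfl
  map_star' _ := rfl

theorem NonUnitalStarAlgHom.continuous_complex {A B : Type*}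
    [NonUnitalCStarAlgebra A] [NonUnitalCStarAlgebra B]
    (f : A →⋆ₙₐ[ℂ] B) : Continuous f :=
  AddMonoidHomClass.continuous_of_bound f 1 fun x => by
    simpa using! NonUnitalStarAlgHom.norm_apply_le f x

/-! ### Paths, cubes and cocycles of `T_k` -/

namespace KGraph

variable {k : ℕ}

theorem T.path_ext {l l' : (T k).Path} (h : l.deg = l'.deg) : l = l' := by
  obtain ⟨a, b, l⟩ := l
  obtain ⟨a', b', l'⟩ := l'
  obtain rfl : l = l' := h
  rfl

theorem T.edge_eq (i : Fin k) (e : (T k).Edge i) : e = tEdge i :=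
  Subtype.ext (T.path_ext (e.2.trans (tEdge i).2.symm))

theorem T.pathsInto_toFinset (v : (T k).Obj) (n : Fin k → ℕ)
    (h : ((T k).pathsInto v n).Finite) : h.toFinset = {tPath n} := by
  ext l
  simp only [Set.Finite.mem_toFinset, Finset.mem_singleton]
  exact ⟨fun hl => T.path_ext hl.2, fun hl => hl ▸ ⟨rfl, rfl⟩⟩

theorem T.deg_comp {μ ν : (T k).Path} (h : μ.src = ν.rng) :
    (μ.comp ν h).deg = μ.deg + ν.deg :=
  rfl

/-- The degree of a cube is the indicator function of its directions; total degree 2 leaves exactly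
two of them, which are then put in order. -/
theorem T.cube_eq_tSquare (c : (T k).Cube 2) :
    ∃ (m n : Fin k) (h : m < n), c = tSquare m n h := by
  have hval : ∀ i, c.1.deg i = if i ∈ c.dirs then 1 else 0 := by
    intro i
    have := c.2.1 i
    simp only [Cube.dirs, Finset.mem_filter, Finset.mem_univ, true_and]
    split_ifs <;> omega
  have hcard : c.dirs.card = 2 := by
    have := c.2.2
    rw [Finset.sum_congr rfl fun i _ => hval i] at this
    simpa using this
  obtain ⟨a, b, hab, hd⟩ := Finset.card_eq_two.1 hcard
  have key : ∀ (m n : Fin k) (h : m < n), c.dirs = {m, n} → c = tSquare m n h := by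
    intro m n h hmn
    refine Subtype.ext (T.path_ext (funext fun i => ?_))
    change c.1.deg i = stdGen m i + stdGen n i
    rw [hval, hmn]
    have := h.ne
    simp only [stdGen, Pi.single_apply, Finset.mem_insert, Finset.mem_singleton]
    split_ifs <;> grind
  rcases hab.lt_or_gt with h | h
  · exact ⟨a, b, h, key a b h hd⟩
  · exact ⟨b, a, h, key b a h (hd.trans (Finset.pair_comm a b))⟩

/-- Opposite faces of a cube of `T_k` coincide. -/
theorem T.face0_eq_face1 {r : ℕ} (l : (T k).Cube (r + 1)) (i : Fin k) (hi : i ∈ l.dirs) :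
    l.face0 i hi = l.face1 i hi := by
  refine Subtype.ext (T.path_ext ?_)
  rw [Cube.face0, Cube.face1, Path.deg_initialPart, Path.deg_finalPart]

/-- The two faces in a given direction enter with opposite signs and are equal, so the coboundary is
zero. -/
theorem T.mem_cocycle {r : ℕ} {A : Type*} [AddCommGroup A] (f : (T k).Cochain r A) :
    f ∈ (T k).Cocycle r A := by
  refine AddMonoidHom.mem_ker.2 (funext fun l => ?_)
  change ∑ i : l.dirs, ((-1 : ℤ) ^ l.pos i • f (l.face0 i i.2) +
    (-1 : ℤ) ^ (l.pos i + 1) • f (l.face1 i i.2)) = 0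
  refine Finset.sum_eq_zero fun i _ => ?_
  rw [T.face0_eq_face1, pow_succ]
  simp

/-! ### Cochains and matrices of phases -/

theorem AddT.val_injective : Function.Injective AddT.val := fun _ _ h =>
  Additive.toMul.injective (Circle.ext h)

/-- A square of `T_k` has a unique description as `e_m + e_n` with `m < n`. -/
theorem tSquare_inj {m n m' n' : Fin k} {h : m < n} {h' : m' < n'}
    (e : tSquare m n h = tSquare m' n' h') : m = m' ∧ n = n' := by
  have hd : ∀ i, stdGen m i + stdGen n i = stdGen m' i + stdGen n' i := fun i =>
    congrFun (congrArg (fun c : (T k).Cube 2 => c.1.deg) e) i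
  have h1 := hd m
  have h2 := hd n
  have h3 := hd m'
  simp only [stdGen, Pi.single_apply] at h1 h2 h3
  grind

/-- The cochain `φ` has the values `φ(e_m + e_n) = e^{2πiθ_{m,n}}` for `m < n`. -/
def IsPhase (φ : (T k).Cochain 2 AddT) (θ : Matrix (Fin k) (Fin k) ℝ) : Prop :=
  ∀ (m n : Fin k) (h : m < n),
    (φ (tSquare m n h)).val = Complex.exp (2 * Real.pi * Complex.I * θ m n)

theorem IsPhase.eq {φ ψ : (T k).Cochain 2 AddT} {θ : Matrix (Fin k) (Fin k) ℝ}
    (hφ : IsPhase φ θ) (hψ : IsPhase ψ θ) : φ = ψ := by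
  funext c
  obtain ⟨m, n, h, rfl⟩ := T.cube_eq_tSquare c
  exact AddT.val_injective ((hφ m n h).trans (hψ m n h).symm)

theorem exists_isPhase (θ : Matrix (Fin k) (Fin k) ℝ) :
    ∃ φ : (T k).Cochain 2 AddT, IsPhase φ θ := by
  choose m n h e using T.cube_eq_tSquare (k := k)
  refine ⟨fun c => Additive.ofMul (Circle.exp (2 * Real.pi * θ (m c) (n c))), fun i j hij => ?_⟩
  -- The indices chosen for the square `e_i + e_j` can only be `i` and `j`.
  obtain ⟨h1, h2⟩ := tSquare_inj (e (tSquare i j hij))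
  change ((Circle.exp _ : Circle) : ℂ) = _
  rw [← h1, ← h2, Circle.coe_exp]
  push_cast
  ring_nf

theorem exists_skew_isPhase (φ : (T k).Cochain 2 AddT) :
    ∃ θ : Matrix (Fin k) (Fin k) ℝ, θ.transpose = -θ ∧ IsPhase φ θ := by
  -- The normalised arguments are placed strictly above the diagonal; since `a` is `0` elsewhere,
  -- antisymmetrising does not change the entries with `m < n`.
  let a : Fin k → Fin k → ℝ := fun m n =>
    if h : m < n then Complex.arg (φ (tSquare m n h)).val / (2 * Real.pi) else 0
  refine ⟨Matrix.of fun m n => a m n - a n m, ?_, fun m n h => ?_⟩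
  · ext m n
    simp
  · have h1 : a n m = 0 := dif_neg h.asymm
    have h2 : a m n = Complex.arg (φ (tSquare m n h)).val / (2 * Real.pi) := dif_pos h
    have h3 : (2 * Real.pi * Complex.I * ((a m n - a n m : ℝ) : ℂ)) =
        Complex.arg (φ (tSquare m n h)).val * Complex.I := by
      rw [h1, h2, sub_zero]
      have := Real.pi_ne_zero
      push_cast
      field_simp
    rw [Matrix.of_apply, h3]
    have h4 : ‖(φ (tSquare m n h)).val‖ = 1 := Circle.norm_coe _
    have := Complex.norm_mul_exp_arg_mul_I (φ (tSquare m n h)).val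
    rw [h4] at this
    simpa using this.symm

variable (hΛ : (T k).RowFiniteLocallyConvex)

theorem isCuntzKriegerRep_of_relations {φ : (T k).Cocycle 2 AddT}
    {θ : Matrix (Fin k) (Fin k) ℝ} (hφ : IsPhase φ.1 θ) {D : Type*} [CStarAlgebra D]
    {w : Fin k → D} (hw : NCTorus.Relations θ w) :
    IsCuntzKriegerRep hΛ φ (fun _ => (1 : D)) (fun i _ => w i) where
  projection _ := .one _
  orthogonal v w h := (h rfl).elim
  ck1 i _ := (Unitary.mem_iff.1 (hw.1 i)).1
  ck2 i j hij μ μ' ν ν' h h' c hc hc' := by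
    have : c = tSquare i j hij := by
      refine Subtype.ext (T.path_ext ?_)
      rw [← hc, T.deg_comp, μ.2, ν.2]
      rfl
    rw [this, hφ, hw.2]
  ck3 v i h := by
    rw [Finset.sum_const, Finset.card_attach, (Unitary.mem_iff.1 (hw.1 i)).2]
    rw [T.pathsInto_toFinset, Finset.card_singleton, one_smul]

universe u

/-! ### Evaluation and density in twisted algebras -/

section General

variable {k : ℕ} {Λ : KGraph.{u} k} (hΛ : Λ.RowFiniteLocallyConvex) (φ : Λ.Cocycle 2 AddT)

/-- The *-homomorphism of `C*_φ(Λ)` induced by a Cuntz-Krieger `φ`-representation. -/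
noncomputable def CKRepresentation.lift (π : CKRepresentation hΛ φ) :
    TwistedAlgebra hΛ φ →⋆ₙₐ[ℂ] π.B :=
  (lp.evalStarAlgHom (fun π : CKRepresentation hΛ φ => π.B) π).comp
    (NonUnitalStarSubalgebraClass.subtype (twistedSubalgebra hΛ φ))

variable {hΛ φ}

/-- An element is its family of coordinates, so any identity valid in all representations passes to
the universal algebra. -/
theorem TwistedAlgebra.ext {x y : TwistedAlgebra hΛ φ}
    (h : ∀ π : CKRepresentation hΛ φ, π.lift hΛ φ x = π.lift hΛ φ y) : x = y :=
  Subtype.ext (lp.ext (funext h))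

variable (hΛ φ) in
-- The algebra is by definition a closure inside the product; the inclusion is a topological
-- embedding, so the closure may be taken in the algebra itself.
theorem twistedAlgebra_adjoin_closure :
    (NonUnitalStarAlgebra.adjoin ℂ (Set.range (twistedP hΛ φ) ∪
      ⋃ i, Set.range (twistedS hΛ φ i))).topologicalClosure = ⊤ := by
  set W := NonUnitalStarAlgebra.adjoin ℂ (Set.range (twistedP hΛ φ) ∪
      ⋃ i, Set.range (twistedS hΛ φ i))
  let ι : TwistedAlgebra hΛ φ →⋆ₙₐ[ℂ] RepProduct hΛ φ :=
    NonUnitalStarSubalgebraClass.subtype (twistedSubalgebra hΛ φ)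
  have hι : Topology.IsInducing ι := Topology.IsInducing.subtypeVal
  have hle : NonUnitalStarAlgebra.adjoin ℂ
      (Set.range (prodP hΛ φ) ∪ ⋃ i, Set.range (prodS hΛ φ i)) ≤ W.map ι := by
    refine NonUnitalStarAlgebra.adjoin_le ?_
    rintro _ (⟨v, rfl⟩ | h)
    · exact ⟨_, NonUnitalStarAlgebra.subset_adjoin ℂ _ (Or.inl ⟨v, rfl⟩), rfl⟩
    · obtain ⟨i, e, rfl⟩ := Set.mem_iUnion.1 h
      exact ⟨_, NonUnitalStarAlgebra.subset_adjoin ℂ _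
        (Or.inr (Set.mem_iUnion.2 ⟨i, e, rfl⟩)), rfl⟩
  refine eq_top_iff.2 fun x _ => ?_
  change x ∈ closure (W : Set (TwistedAlgebra hΛ φ))
  rw [hι.closure_eq_preimage_closure_image]
  exact closure_mono hle x.2

end General

end KGraph

/-! ### The universal property of `A_θ` -/

namespace NCTorus

variable {k : ℕ} {θ : Matrix (Fin k) (Fin k) ℝ}

theorem relations_of_injective {D B : Type*} [CStarAlgebra D] [CStarAlgebra B] (f : D →⋆ₐ[ℂ] B)
    (hf : Function.Injective f) {w : Fin k → D} (h : Relations θ fun i => f (w i)) :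
    Relations θ w := by
  refine ⟨fun m => ?_, fun m n => hf ?_⟩
  · have := Unitary.mem_iff.1 (h.1 m)
    exact Unitary.mem_iff.2 ⟨hf (by simpa [map_star] using this.1),
      hf (by simpa [map_star] using this.2)⟩
  · simpa using h.2 m n

theorem exists_small_relations {B : Type*} [CStarAlgebra B] {w : Fin k → B}
    (h : Relations θ w) :
    ∃ (D : Type) (_ : CStarAlgebra D) (f : D →⋆ₐ[ℂ] B) (w' : Fin k → D),
      Relations θ w' ∧ ∀ i, f (w' i) = w i := by
  obtain ⟨D, hD, f, w', hf, hw⟩ := exists_small_lift w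
  refine ⟨D, hD, f, w', relations_of_injective f hf ?_, hw⟩
  rwa [funext hw]

variable (θ) in
theorem relations_gen : Relations θ (gen θ) := by
  refine ⟨fun m => Unitary.mem_iff.2 ⟨?_, ?_⟩, fun m n => ?_⟩ <;>
    refine Subtype.ext (lp.ext (funext fun π => ?_))
  · exact (Unitary.mem_iff.1 (π.rel.1 m)).1
  · exact (Unitary.mem_iff.1 (π.rel.1 m)).2
  · exact π.rel.2 m n

/-- The *-homomorphism of `A_θ` induced by a representation of its relations. -/
noncomputable def Representation.lift (π : Representation θ) : NCTorus θ →⋆ₙₐ[ℂ] π.B :=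
  (lp.evalStarAlgHom (fun π : Representation θ => π.B) π).comp
    (NonUnitalStarSubalgebraClass.subtype (torusSubalgebra θ))

theorem hom_ext {B : Type*} [NonUnitalCStarAlgebra B] {f g : NCTorus θ →⋆ₙₐ[ℂ] B}
    (h1 : f 1 = g 1) (h : ∀ i, f (gen θ i) = g (gen θ i)) : f = g := by
  let ι : NCTorus θ →⋆ₐ[ℂ] RepProduct θ := (torusSubalgebra θ).subtype
  have hι : Topology.IsInducing ι := Topology.IsInducing.subtypeVal
  let W : StarSubalgebra ℂ (NCTorus θ) :=
    -- The maps need not be unital; agreement at `1` is what puts the scalars into the equalizer.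
    { NonUnitalStarAlgHom.equalizer f g with
      algebraMap_mem' := fun r => by
        change f (algebraMap ℂ _ r) = g (algebraMap ℂ _ r)
        rw [Algebra.algebraMap_eq_smul_one, map_smul, map_smul, h1]
      one_mem' := h1 }
  have hle : StarAlgebra.adjoin ℂ (Set.range (prodU θ)) ≤ W.map ι := by
    refine StarAlgebra.adjoin_le ?_
    rintro _ ⟨i, rfl⟩
    exact ⟨gen θ i, h i, rfl⟩
  have hW : IsClosed (W : Set (NCTorus θ)) := isClosed_eq f.continuous_complex g.continuous_complex
  refine DFunLike.ext _ _ fun x => ?_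
  change x ∈ (W : Set (NCTorus θ))
  rw [← hW.closure_eq, hι.closure_eq_preimage_closure_image]
  exact closure_mono hle x.2

/-- The universal property of `A_θ`. -/
theorem exists_lift {B : Type*} [CStarAlgebra B] {w : Fin k → B} (h : Relations θ w) :
    ∃ π : NCTorus θ →⋆ₙₐ[ℂ] B, π 1 = 1 ∧ ∀ i, π (gen θ i) = w i := by
  obtain ⟨D, hD, f, w', hw', hf⟩ := exists_small_relations h
  cases subsingleton_or_nontrivial D
  -- `Representation` admits only nonzero algebras. If `D` is zero, so is `B`, because `f` is
  -- unital, and the zero map serves.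
  · have h0 : (1 : B) = 0 := by
      rw [← map_one f, ← map_zero f, Subsingleton.elim (1 : D) 0]
    have := subsingleton_of_zero_eq_one h0.symm
    exact ⟨0, Subsingleton.elim _ _, fun i => Subsingleton.elim _ _⟩
  · let π : Representation θ := ⟨D, w', hw'⟩
    exact ⟨(f : D →⋆ₙₐ[ℂ] B).comp π.lift, map_one f, hf⟩

end NCTorus

/-! ### Structure and universal property of `C*_φ(T_k)` -/

namespace KGraph

variable {k : ℕ} {φ : (T k).Cocycle 2 AddT} {θ : Matrix (Fin k) (Fin k) ℝ}

variable (φ) in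
theorem adjoin_closure_tP_tS :
    (NonUnitalStarAlgebra.adjoin ℂ (insert (tP φ) (Set.range (tS φ)))).topologicalClosure = ⊤ := by
  rw [← twistedAlgebra_adjoin_closure (tRowFiniteLocallyConvex k) φ]
  congr 2
  have h1 : Set.range (twistedP (tRowFiniteLocallyConvex k) φ) = {tP φ} :=
    Set.eq_singleton_iff_unique_mem.2 ⟨⟨tVertex, rfl⟩, by rintro _ ⟨v, rfl⟩; rfl⟩
  have h2 : ∀ i, Set.range (twistedS (tRowFiniteLocallyConvex k) φ i) = {tS φ i} := fun i =>
    Set.eq_singleton_iff_unique_mem.2 ⟨⟨tEdge i, rfl⟩, by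
      rintro _ ⟨e, rfl⟩; rw [T.edge_eq i e]; rfl⟩
  simp only [h1, h2, Set.iUnion_singleton_eq_range, Set.insert_eq]

theorem star_tS_mul_tS (i : Fin k) : star (tS φ i) * tS φ i = tP φ :=
  TwistedAlgebra.ext fun π => π.isRep.ck1 i (tEdge i)

theorem tS_mul_star_tS (i : Fin k) : tS φ i * star (tS φ i) = tP φ := by
  refine TwistedAlgebra.ext fun π => ?_
  have h := π.isRep.ck3 tVertex i ⟨tPath (stdGen i), rfl, rfl⟩
  rw [Finset.sum_congr rfl fun e _ => by rw [T.edge_eq i ⟨e.1, _⟩]] at h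
  rw [Finset.sum_const, Finset.card_attach, T.pathsInto_toFinset, Finset.card_singleton,
    one_smul] at h
  exact h.symm

theorem isStarProjection_tP : IsStarProjection (tP φ) where
  isIdempotentElem := TwistedAlgebra.ext fun π =>
    (π.isRep.projection tVertex).isIdempotentElem
  isSelfAdjoint := TwistedAlgebra.ext fun π => (π.isRep.projection tVertex).isSelfAdjoint

/-- Both sides equal `S S* S`, as `p_0` is both `S S*` and `S* S`. -/
theorem tP_mul_tS (i : Fin k) : tP φ * tS φ i = tS φ i * tP φ := by
  rw [← tS_mul_star_tS i, mul_assoc, star_tS_mul_tS, tS_mul_star_tS]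

/-- For `x = S p - S` with `S* S = p` a projection, `x* x = p - p - p + p = 0`, and the C*-identity
gives `x = 0`. -/
theorem tS_mul_tP (i : Fin k) : tS φ i * tP φ = tS φ i := by
  have h : star (tS φ i * tP φ - tS φ i) * (tS φ i * tP φ - tS φ i) = 0 := by
    simp only [star_sub, star_mul, isStarProjection_tP.isSelfAdjoint.star_eq, sub_mul, mul_sub]
    simp only [mul_assoc]
    simp only [← mul_assoc (star (tS φ i)), star_tS_mul_tS,
      isStarProjection_tP.isIdempotentElem.eq]
    simp
  exact sub_eq_zero.1 (CStarRing.star_mul_self_eq_zero_iff _ |>.1 h)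

/-- Induction on generators, applied to equalizers and to the set of elements on which `p_0` acts as
a unit. -/
theorem mem_of_isClosed {W : NonUnitalStarSubalgebra ℂ (TAlgebra φ)}
    (hW : IsClosed (W : Set (TAlgebra φ))) (hP : tP φ ∈ W) (hS : ∀ i, tS φ i ∈ W)
    (x : TAlgebra φ) : x ∈ W := by
  have h : NonUnitalStarAlgebra.adjoin ℂ (insert (tP φ) (Set.range (tS φ))) ≤ W := by
    refine NonUnitalStarAlgebra.adjoin_le ?_
    rintro _ (rfl | ⟨i, rfl⟩)
    exacts [hP, hS i]
  have h2 := NonUnitalStarSubalgebra.topologicalClosure_minimal _ h hW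
  rw [adjoin_closure_tP_tS] at h2
  exact h2 trivial

theorem hom_ext {B : Type*} [NonUnitalCStarAlgebra B] {f g : TAlgebra φ →⋆ₙₐ[ℂ] B}
    (hP : f (tP φ) = g (tP φ)) (hS : ∀ i, f (tS φ i) = g (tS φ i)) : f = g :=
  DFunLike.ext _ _ (mem_of_isClosed (W := NonUnitalStarAlgHom.equalizer f g)
    (isClosed_eq f.continuous_complex g.continuous_complex) hP hS)

theorem tP_unit (x : TAlgebra φ) : tP φ * x = x ∧ x * tP φ = x := by
  have hs := (isStarProjection_tP (φ := φ)).isSelfAdjoint.star_eq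
  let W : NonUnitalStarSubalgebra ℂ (TAlgebra φ) :=
    -- Both conditions are imposed together because the adjoint interchanges them.
    { carrier := {x | tP φ * x = x ∧ x * tP φ = x}
      add_mem' := fun {a b} ha hb => by
        simp only [Set.mem_ofPred_eq] at *
        rw [mul_add, add_mul, ha.1, ha.2, hb.1, hb.2]
        exact ⟨rfl, rfl⟩
      zero_mem' := by simp
      mul_mem' := fun {a b} ha hb => by
        simp only [Set.mem_ofPred_eq] at *
        rw [← mul_assoc, ha.1, mul_assoc, hb.2]
        exact ⟨rfl, rfl⟩
      smul_mem' := fun c {a} ha => by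
        simp only [Set.mem_ofPred_eq] at *
        rw [mul_smul_comm, smul_mul_assoc, ha.1, ha.2]
        exact ⟨rfl, rfl⟩
      star_mem' := fun {a} ha => by
        simp only [Set.mem_ofPred_eq] at *
        have h1 := congrArg star ha.1
        have h2 := congrArg star ha.2
        rw [star_mul, hs] at h1 h2
        exact ⟨h2, h1⟩ }
  have hp := (isStarProjection_tP (φ := φ)).isIdempotentElem.eq
  refine mem_of_isClosed (W := W) ?_ ⟨hp, hp⟩
    (fun i => ⟨(tP_mul_tS i).trans (tS_mul_tP i), tS_mul_tP i⟩) x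
  exact (isClosed_eq (continuous_const_mul _) continuous_id).inter
    (isClosed_eq (continuous_mul_const _) continuous_id)

theorem exists_lift (hφ : IsPhase φ.1 θ) {B : Type*} [CStarAlgebra B] {w : Fin k → B}
    (h : NCTorus.Relations θ w) :
    ∃ π : TAlgebra φ →⋆ₙₐ[ℂ] B, π (tP φ) = 1 ∧ ∀ i, π (tS φ i) = w i := by
  obtain ⟨D, hD, f, w', hw', hf⟩ := NCTorus.exists_small_relations h
  let π : CKRepresentation (tRowFiniteLocallyConvex k) φ :=
    ⟨D, _, _, isCuntzKriegerRep_of_relations _ hφ hw'⟩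
  exact ⟨(f : D →⋆ₙₐ[ℂ] B).comp (π.lift _ φ), map_one f, hf⟩

theorem tS_commutation (hθ : θ.transpose = -θ) (hφ : IsPhase φ.1 θ) (m n : Fin k) :
    tS φ n * tS φ m = Complex.exp (2 * Real.pi * Complex.I * θ m n) • (tS φ m * tS φ n) := by
  have hlt : ∀ m n : Fin k, m < n → tS φ n * tS φ m =
      Complex.exp (2 * Real.pi * Complex.I * θ m n) • (tS φ m * tS φ n) := by
    intro m n h
    rw [← hφ m n h]
    -- The square factors as `e_m` followed by `e_n` and in the other order, with the same two
    -- edges.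
    exact TwistedAlgebra.ext fun π => π.isRep.ck2 m n h (tEdge m) (tEdge m) (tEdge n) (tEdge n)
      rfl rfl (tSquare m n h) (T.path_ext rfl) (T.path_ext (add_comm _ _))
  have hskew : θ m n = -θ n m := congrFun (congrFun hθ n) m
  -- Skew-symmetry makes the phase `1` on the diagonal and inverts it when the indices are
  -- exchanged.
  rcases lt_trichotomy m n with h | rfl | h
  · exact hlt m n h
  · have : θ m m = 0 := by linarith
    simp [this]
  · rw [hlt n m h, smul_smul, ← Complex.exp_add, hskew]
    simp

/-- `C*_{φ(θ)}(T_k)` is isomorphic to `A_θ`. -/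
theorem exists_equiv (hθ : θ.transpose = -θ) (hφ : IsPhase φ.1 θ) :
    ∃ Ψ : TAlgebra φ ≃⋆ₐ[ℂ] NCTorus θ,
      Ψ (tP φ) = 1 ∧ ∀ i : Fin k, Ψ (tS φ i) = NCTorus.gen θ i := by
  obtain ⟨f, hf1, hf⟩ := exists_lift hφ (NCTorus.relations_gen θ)
  have hg : ∃ g : NCTorus θ →⋆ₙₐ[ℂ] TAlgebra φ, g 1 = tP φ ∧
      ∀ i, g (NCTorus.gen θ i) = tS φ i :=
    -- The unital structure has `1 = p_0` and keeps the given operations and norm, so the map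
    -- obtained from it is one into the original algebra.
    let _ : CStarAlgebra (TAlgebra φ) :=
      NonUnitalCStarAlgebra.cstarAlgebraOfUnit inferInstance (tP φ) tP_unit
    NCTorus.exists_lift (θ := θ) (w := tS φ) ⟨fun m =>
      Unitary.mem_iff.2 ⟨star_tS_mul_tS m, tS_mul_star_tS m⟩, tS_commutation hθ hφ⟩
  obtain ⟨g, hg1, hg⟩ := hg
  have h1 : g.comp f = NonUnitalStarAlgHom.id ℂ _ :=
    hom_ext (by simp [hf1, hg1]) (by simp [hf, hg])
  have h2 : f.comp g = NonUnitalStarAlgHom.id ℂ _ :=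
    NCTorus.hom_ext (by simp [hf1, hg1]) (by simp [hf, hg])
  exact ⟨StarAlgEquiv.ofBijective f
    ⟨Function.LeftInverse.injective (g := g) (DFunLike.congr_fun h1),
      Function.RightInverse.surjective (g := g) (DFunLike.congr_fun h2)⟩, hf1, hf⟩

end KGraph

theorem mainTheorem7 (k : ℕ) :
    (∀ θ : Matrix (Fin k) (Fin k) ℝ, θ.transpose = -θ →
      -- the values on the squares `e_m + e_n` determine a cochain `φ(θ)`, which is a `2`-cocycle
      ∃ φ : (KGraph.T k).Cocycle 2 KGraph.AddT,
        (∀ ψ : (KGraph.T k).Cochain 2 KGraph.AddT,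
          (∀ (m n : Fin k) (h : m < n),
            (ψ (KGraph.tSquare m n h)).val = Complex.exp (2 * Real.pi * Complex.I * θ m n)) ↔
          ψ = φ.1) ∧
        -- `C*_{φ(θ)}(T_k)` has the unit `p_0` and is generated by the unitaries `S_{e_i}`,
        -- which satisfy the relations of `A_θ`
        (∀ x : KGraph.TAlgebra φ, KGraph.tP φ * x = x ∧ x * KGraph.tP φ = x) ∧
        (∀ i : Fin k, star (KGraph.tS φ i) * KGraph.tS φ i = KGraph.tP φ ∧
          KGraph.tS φ i * star (KGraph.tS φ i) = KGraph.tP φ) ∧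
        (∀ m n : Fin k, KGraph.tS φ n * KGraph.tS φ m =
          Complex.exp (2 * Real.pi * Complex.I * θ m n) • (KGraph.tS φ m * KGraph.tS φ n)) ∧
        (NonUnitalStarAlgebra.adjoin ℂ
          (insert (KGraph.tP φ) (Set.range (KGraph.tS φ)))).topologicalClosure = ⊤ ∧
        -- and it is universal for these relations
        (∀ (B : Type*) [CStarAlgebra B] (w : Fin k → B), NCTorus.Relations θ w →
          ∃! π : KGraph.TAlgebra φ →⋆ₙₐ[ℂ] B,
            π (KGraph.tP φ) = 1 ∧ ∀ i : Fin k, π (KGraph.tS φ i) = w i) ∧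
        -- `C*_{φ(θ)}(T_k)` is isomorphic to `A_θ`
        (∃ Ψ : KGraph.TAlgebra φ ≃⋆ₐ[ℂ] NCTorus θ,
          Ψ (KGraph.tP φ) = 1 ∧ ∀ i : Fin k, Ψ (KGraph.tS φ i) = NCTorus.gen θ i)) ∧
    -- conversely, every twisted algebra of `T_k` is the one of some skew-symmetric matrix
    (∀ φ : (KGraph.T k).Cocycle 2 KGraph.AddT,
      ∃ θ : Matrix (Fin k) (Fin k) ℝ, θ.transpose = -θ ∧
        (∀ (m n : Fin k) (h : m < n),
          (φ.1 (KGraph.tSquare m n h)).val = Complex.exp (2 * Real.pi * Complex.I * θ m n)) ∧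
        ∃ Ψ : KGraph.TAlgebra φ ≃⋆ₐ[ℂ] NCTorus θ,
          Ψ (KGraph.tP φ) = 1 ∧ ∀ i : Fin k, Ψ (KGraph.tS φ i) = NCTorus.gen θ i) := by
  refine ⟨fun θ hθ => ?_, fun φ => ?_⟩
  · obtain ⟨f, hf⟩ := KGraph.exists_isPhase θ
    let φ : (KGraph.T k).Cocycle 2 KGraph.AddT := ⟨f, KGraph.T.mem_cocycle f⟩
    have hφ : KGraph.IsPhase φ.1 θ := hf
    refine ⟨φ, fun ψ => ⟨fun h => KGraph.IsPhase.eq h hf, fun h => h ▸ hf⟩, KGraph.tP_unit,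
      fun i => ⟨KGraph.star_tS_mul_tS i, KGraph.tS_mul_star_tS i⟩, KGraph.tS_commutation hθ hφ,
      KGraph.adjoin_closure_tP_tS φ, fun B _ w hw => ?_, KGraph.exists_equiv hθ hφ⟩
    obtain ⟨π, h1, h2⟩ := KGraph.exists_lift hφ hw
    exact ⟨π, ⟨h1, h2⟩, fun ρ hρ => KGraph.hom_ext (hρ.1.trans h1.symm)
      fun i => (hρ.2 i).trans (h2 i).symm⟩
  · obtain ⟨θ, hθ, hφ⟩ := KGraph.exists_skew_isPhase φ.1
    exact ⟨θ, hθ, hφ, KGraph.exists_equiv hθ hφ⟩
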